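/- Let $\mathsf F=(f_{n,k})_{n,k\ge 0}$ and $\mathsf T=(t_{n,k})_{n,k\ge 0}$ be the infinite lower-triangular matrices with entries $$f_{n,k}=\binom{n-1}{k-1}n^{n-k}\quad (n\ge k\ge 1),\qquad f_{n,0}=\delta_{n0},\qquad f_{n,k}=0\quad (k>n),$$ $$t_{n,k}=\binom{n}{k}n^{n-k}\quad (n\ge k\ge 0),\qquad t_{n,k}=0\quad (k>n),$$ where $0^0=1$ and $\delta_{n0}$ is $1$ if $n=0$ and $0$ otherwise. Then $\mathsf F$ and $\mathsf T$ are totally positive, that is, every minor of each of them is nonnegative: for all $r\ge 0$ and all indices $0\le n_1<\dots<n_r$ and $0\le k_1<\dots<k_r$, $$\det\bigl(f_{n_i,k_j}\bigr)_{1\le i,j\le r}\ge 0\qquad\text{and}\qquad \det\bigl(t_{n_i,k_j}\bigr)_{1\le i,j\le r}\ge 0 .$$ -/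

import Mathlib

/-- A (possibly infinite) real matrix with linearly ordered row and column indices is totally
positive if all of its minors are nonnegative: for every `r` and every choice of `r` rows and
`r` columns, both listed in increasing order, the determinant of the corresponding square
submatrix is nonnegative. -/
def Matrix.IsTotallyPositive {m n : Type*} [LinearOrder m] [LinearOrder n]
    (A : Matrix m n ℝ) : Prop :=
  ∀ (r : ℕ) (rows : Fin r → m) (cols : Fin r → n), StrictMono rows → StrictMono cols →
    0 ≤ (A.submatrix rows cols).det

/-- The forest numbers `f n k`: `δ_{n0}` if `k = 0`, `C(n-1, k-1) n^(n-k)` if `1 ≤ k ≤ n`, and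
`0` if `k > n`. The subtractions are evaluated only where they do not truncate. -/
def forestNumber (n k : ℕ) : ℕ :=
  if k = 0 then (if n = 0 then 1 else 0)
  else if k ≤ n then (n - 1).choose (k - 1) * n ^ (n - k)
  else 0

/-- The tree numbers `t n k = C(n, k) n^(n-k)`, which vanish for `k > n` since the binomial
coefficient does; `t 0 0 = 1`. -/
def treeNumber (n k : ℕ) : ℕ :=
  n.choose k * n ^ (n - k)

/-- The forests matrix `F`, rows and columns indexed from `0`. -/
def forestsMatrix : Matrix ℕ ℕ ℝ :=
  Matrix.of fun n k => (forestNumber n k : ℝ)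

/-- The trees matrix `T`, rows and columns indexed from `0`. -/
def treesMatrix : Matrix ℕ ℕ ℝ :=
  Matrix.of fun n k => (treeNumber n k : ℝ)

/-!
Write `S` for the lower-triangular matrix of ones, `P` for Pascal's matrix and
`D = (n! / k!)_{n ≥ k}`, and let `1 ⊕ A` be the direct sum of the `1 × 1` identity and `A`. Then
`P = S (1 ⊕ P)`, `T = F D` and `F = 1 ⊕ (T P)`. The matrix `S` is totally positive by inspection,
`D` is a diagonal rescaling of `S`, and by the Cauchy–Binet formula total positivity passes to
products, so the three identities propagate it to larger and larger leading submatrices of `P`, `F`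
and `T`. All the matrices are lower triangular, so the identities hold for leading submatrices.
-/

open Finset Matrix

section Determinants

variable {R : Type*} [CommRing R]

theorem det_mul_eq_sum_prod_mul_det {ι κ : Type*} [Fintype ι] [DecidableEq ι] [Fintype κ]
    (A : Matrix ι κ R) (B : Matrix κ ι R) :
    (A * B).det = ∑ f : ι → κ, (∏ i, A i (f i)) * (B.submatrix f id).det := by
  classical
  let detRows := (detRowAlternating (n := ι) (R := R)).toMultilinearMap
  have rows_eq : A * B = fun i => ∑ j, A i j • B j := by
    ext i k
    simp [mul_apply]
  calc (A * B).det = detRows fun i => ∑ j, A i j • B j := congrArg det rows_eq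
    _ = ∑ f : ι → κ, detRows fun i => A i (f i) • B (f i) := detRows.map_sum _
    _ = ∑ f : ι → κ, (∏ i, A i (f i)) * (B.submatrix f id).det :=
      sum_congr rfl fun f _ => detRows.map_smul_univ (fun i => A i (f i)) fun i => B (f i)

/-- The Cauchy–Binet formula. Summing over all maps `ι → κ`, rather than over subsets of `κ`,
counts each subset `(card ι)!` times. -/
theorem factorial_card_mul_det_mul {ι κ : Type*} [Fintype ι] [DecidableEq ι] [Fintype κ]
    (A : Matrix ι κ R) (B : Matrix κ ι R) :
    ((Fintype.card ι).factorial : R) * (A * B).det =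
      ∑ f : ι → κ, (A.submatrix id f).det * (B.submatrix f id).det := by
  classical
  have reindexed (σ : Equiv.Perm ι) : (A * B).det =
      ∑ f : ι → κ, (σ.sign : R) * (∏ i, A i (f (σ i))) * (B.submatrix f id).det := by
    rw [det_mul_eq_sum_prod_mul_det, ← (σ.symm.arrowCongr (Equiv.refl κ)).sum_comp]
    refine sum_congr rfl fun f _ => ?_
    change (∏ i, A i (f (σ i))) * ((B.submatrix f id).submatrix σ id).det = _
    rw [det_permute]
    ring
  calc ((Fintype.card ι).factorial : R) * (A * B).det = ∑ _σ : Equiv.Perm ι, (A * B).det := by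
        simp [Fintype.card_perm]
    _ = ∑ f : ι → κ, ∑ σ : Equiv.Perm ι,
          (σ.sign : R) * (∏ i, A i (f (σ i))) * (B.submatrix f id).det := by
        rw [sum_congr rfl fun σ _ => reindexed σ, sum_comm]
    _ = ∑ f : ι → κ, (A.submatrix id f).det * (B.submatrix f id).det := by
        refine sum_congr rfl fun f _ => ?_
        rw [← sum_mul, ← det_transpose (A.submatrix id f), det_apply' (A.submatrix id f)ᵀ]
        rfl

theorem det_eq_mul_of_row_zero_tail_eq_zero {r : ℕ} (A : Matrix (Fin (r + 1)) (Fin (r + 1)) R)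
    (h : ∀ j : Fin r, A 0 j.succ = 0) :
    A.det = A 0 0 * (A.submatrix Fin.succ Fin.succ).det := by
  rw [det_succ_row_zero, Fin.sum_univ_succ, sum_eq_zero fun j _ => by simp [h j]]
  simp

end Determinants

section TotalPositivity

variable {m n κ : Type*} [LinearOrder m] [LinearOrder n] [LinearOrder κ]

theorem isTotallyPositive_mul [Fintype κ] {A : Matrix m κ ℝ} {B : Matrix κ n ℝ}
    (hA : A.IsTotallyPositive) (hB : B.IsTotallyPositive) : (A * B).IsTotallyPositive := by
  intro r rows cols hrows hcols
  rw [submatrix_mul A B rows id cols Function.bijective_id]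
  set A' := A.submatrix rows id
  set B' := B.submatrix id cols
  have minors_mul_nonneg (f : Fin r → κ) :
      0 ≤ (A'.submatrix id f).det * (B'.submatrix f id).det := by
    by_cases hf : f.Injective
    · -- Sorting `f` changes both determinants by the same sign.
      set σ := Tuple.sort f
      have hσ : StrictMono (f ∘ σ) :=
        (Tuple.monotone_sort f).strictMono_of_injective (hf.comp σ.injective)
      have sorted_nonneg : 0 ≤ ((A'.submatrix id f).submatrix id σ).det *
          ((B'.submatrix f id).submatrix σ id).det :=
        mul_nonneg (hA r rows _ hrows hσ) (hB r _ cols hσ hcols)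
      rw [det_permute, det_permute', mul_mul_mul_comm, ← Int.cast_mul] at sorted_nonneg
      simpa using sorted_nonneg
    · obtain ⟨i, j, hij, hne⟩ : ∃ i j, f i = f j ∧ i ≠ j := by
        simpa [Function.Injective] using hf
      rw [det_zero_of_column_eq hne fun k => by simp [hij], zero_mul]
  have hcard : (0 : ℝ) < (Fintype.card (Fin r)).factorial := by positivity
  refine nonneg_of_mul_nonneg_right ?_ hcard
  rw [factorial_card_mul_det_mul]
  exact sum_nonneg fun f _ => minors_mul_nonneg f

theorem isTotallyPositive_scale {A : Matrix m n ℝ} (hA : A.IsTotallyPositive) {d : m → ℝ}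
    {e : n → ℝ} (hd : ∀ i, 0 ≤ d i) (he : ∀ j, 0 ≤ e j) :
    (of fun i j => d i * (e j * A i j)).IsTotallyPositive := by
  intro r rows cols hrows hcols
  have minor_eq : ((of fun i j => d i * (e j * A i j)).submatrix rows cols).det =
      (∏ i, d (rows i)) * ((∏ j, e (cols j)) * (A.submatrix rows cols).det) := by
    rw [← det_mul_row, ← det_mul_column]
    rfl
  rw [minor_eq]
  exact mul_nonneg (prod_nonneg fun _ _ => hd _)
    (mul_nonneg (prod_nonneg fun _ _ => he _) (hA r rows cols hrows hcols))

theorem isTotallyPositive_of_isEmpty [IsEmpty m] (A : Matrix m n ℝ) : A.IsTotallyPositive := by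
  rintro (_ | r) rows cols - -
  · simp
  · exact isEmptyElim (rows 0)

variable (n) in
/-- The lower-triangular matrix over a linear order whose entries on and below the diagonal are all
equal to `1`: summation over initial segments, as a matrix. -/
def lowerOnes : Matrix n n ℝ := of fun i j => if j ≤ i then 1 else 0

theorem lowerOnes_isTotallyPositive : (lowerOnes n).IsTotallyPositive := by
  intro r
  induction r with
  | zero => simp
  | succ r ih =>
    intro rows cols hrows hcols
    by_cases h : ∃ j : Fin r, cols j.succ ≤ rows 0
    · obtain ⟨j, hj⟩ := h
      have column_eq_one {k : Fin (r + 1)} (hk : k ≤ j.succ) (i : Fin (r + 1)) :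
          lowerOnes n (rows i) (cols k) = 1 :=
        if_pos ((hcols.monotone hk).trans (hj.trans (hrows.monotone i.zero_le)))
      refine (det_zero_of_column_eq (Fin.succ_ne_zero j) fun i => ?_).ge
      exact (column_eq_one le_rfl i).trans (column_eq_one (Fin.zero_le _) i).symm
    · push Not at h
      rw [det_eq_mul_of_row_zero_tail_eq_zero _ fun j => if_neg (h j).not_ge, submatrix_submatrix]
      refine mul_nonneg ?_
        (ih _ _ (hrows.comp Fin.strictMono_succ) (hcols.comp Fin.strictMono_succ))
      simp only [submatrix_apply, lowerOnes, of_apply]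
      positivity

end TotalPositivity

section OneDirectSum

variable {R : Type*} [Zero R] [One R] {p q : ℕ}

/-- The direct sum `1 ⊕ A` of the `1 × 1` identity matrix and `A`. -/
def oneDirectSum (A : Matrix (Fin p) (Fin q) R) : Matrix (Fin (p + 1)) (Fin (q + 1)) R :=
  of (vecCons (vecCons 1 0) fun i => vecCons 0 (A i))

variable (A : Matrix (Fin p) (Fin q) R)

@[simp]
theorem oneDirectSum_zero_zero : oneDirectSum A 0 0 = 1 := rfl

@[simp]
theorem oneDirectSum_zero_succ (j : Fin q) : oneDirectSum A 0 j.succ = 0 := rfl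

@[simp]
theorem oneDirectSum_succ_zero (i : Fin p) : oneDirectSum A i.succ 0 = 0 := rfl

@[simp]
theorem oneDirectSum_succ_succ (i : Fin p) (j : Fin q) :
    oneDirectSum A i.succ j.succ = A i j := rfl

end OneDirectSum

theorem exists_strictMono_eq_succ_comp {α : Type*} [Preorder α] {p : ℕ} {f : α → Fin (p + 1)}
    (hf : StrictMono f) (hpos : ∀ i, f i ≠ 0) : ∃ g : α → Fin p, StrictMono g ∧ f = Fin.succ ∘ g :=
  ⟨fun i => (f i).pred (hpos i), fun _ _ hij => Fin.pred_lt_pred_iff.2 (hf hij),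
    funext fun i => (Fin.succ_pred (f i) (hpos i)).symm⟩

theorem oneDirectSum_isTotallyPositive {p q : ℕ} {A : Matrix (Fin p) (Fin q) ℝ}
    (hA : A.IsTotallyPositive) : (oneDirectSum A).IsTotallyPositive := by
  have minor_nonneg_of_ne_zero {r : ℕ} {rows : Fin r → Fin (p + 1)} {cols : Fin r → Fin (q + 1)}
      (hrows : StrictMono rows) (hcols : StrictMono cols) (hrows_ne : ∀ i, rows i ≠ 0)
      (hcols_ne : ∀ j, cols j ≠ 0) : 0 ≤ ((oneDirectSum A).submatrix rows cols).det := by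
    obtain ⟨rows', hrows', rfl⟩ := exists_strictMono_eq_succ_comp hrows hrows_ne
    obtain ⟨cols', hcols', rfl⟩ := exists_strictMono_eq_succ_comp hcols hcols_ne
    exact hA r rows' cols' hrows' hcols'
  rintro (_ | r) rows cols hrows hcols
  · simp
  have tail_ne_zero {l : ℕ} {f : Fin (r + 1) → Fin (l + 1)} (hf : StrictMono f) (j : Fin r) :
      f j.succ ≠ 0 := (hf j.succ_pos).ne_bot
  have all_ne_zero {l : ℕ} {f : Fin (r + 1) → Fin (l + 1)} (hf : StrictMono f) (h0 : f 0 ≠ 0) :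
      ∀ j, f j ≠ 0 := Fin.cases h0 (tail_ne_zero hf)
  have zero_apply {k : Fin (q + 1)} (hk : k ≠ 0) : oneDirectSum A 0 k = 0 := by
    obtain ⟨k, rfl⟩ := Fin.exists_succ_eq.2 hk
    simp
  have apply_zero {k : Fin (p + 1)} (hk : k ≠ 0) : oneDirectSum A k 0 = 0 := by
    obtain ⟨k, rfl⟩ := Fin.exists_succ_eq.2 hk
    simp
  by_cases hr0 : rows 0 = 0
  · have head_nonneg : 0 ≤ oneDirectSum A 0 (cols 0) := by
      cases cols 0 using Fin.cases <;> simp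
    rw [det_eq_mul_of_row_zero_tail_eq_zero _ fun j => by
      rw [submatrix_apply, hr0, zero_apply (tail_ne_zero hcols j)],
      submatrix_apply, hr0, submatrix_submatrix]
    exact mul_nonneg head_nonneg (minor_nonneg_of_ne_zero (hrows.comp Fin.strictMono_succ)
      (hcols.comp Fin.strictMono_succ) (tail_ne_zero hrows) (tail_ne_zero hcols))
  · by_cases hc0 : cols 0 = 0
    · exact (det_eq_zero_of_column_eq_zero 0 fun i => by
        rw [submatrix_apply, hc0, apply_zero (all_ne_zero hrows hr0 i)]).ge
    · exact minor_nonneg_of_ne_zero hrows hcols (all_ne_zero hrows hr0) (all_ne_zero hcols hc0)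

/-- The leading (northwest) `N × N` submatrix of an infinite matrix. -/
def leadingSubmatrix {R : Type*} (A : Matrix ℕ ℕ R) (N : ℕ) : Matrix (Fin N) (Fin N) R :=
  A.submatrix Fin.val Fin.val

theorem isTotallyPositive_of_leadingSubmatrix {A : Matrix ℕ ℕ ℝ}
    (h : ∀ N, (leadingSubmatrix A N).IsTotallyPositive) : A.IsTotallyPositive := by
  intro r rows cols hrows hcols
  obtain ⟨M, hM⟩ := Finite.exists_le rows
  obtain ⟨K, hK⟩ := Finite.exists_le cols
  exact h (max M K + 1) r
    (fun i => ⟨rows i, Nat.lt_succ_of_le ((hM i).trans (le_max_left M K))⟩)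
    (fun j => ⟨cols j, Nat.lt_succ_of_le ((hK j).trans (le_max_right M K))⟩)
    (fun _ _ hij => hrows hij) (fun _ _ hij => hcols hij)

/-- Pascal's lower-triangular matrix of binomial coefficients. -/
def pascalMatrix : Matrix ℕ ℕ ℝ := of fun n k => (n.choose k : ℝ)

theorem sum_range_choose_eq_choose_succ (n k : ℕ) :
    ∑ i ∈ range n, i.choose k = n.choose (k + 1) := by
  induction n with
  | zero => simp
  | succ n ih => rw [sum_range_succ, ih, Nat.choose_succ_succ, add_comm]

theorem leadingSubmatrix_pascalMatrix_succ (N : ℕ) :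
    leadingSubmatrix pascalMatrix (N + 1) =
      lowerOnes (Fin (N + 1)) * oneDirectSum (leadingSubmatrix pascalMatrix N) := by
  ext n k
  rw [mul_apply, Fin.sum_univ_succ]
  cases k using Fin.cases with
  | zero => simp [leadingSubmatrix, pascalMatrix, lowerOnes]
  | succ k =>
    have hfilter : {i ∈ range N | i + 1 ≤ (n : ℕ)} = range n := by
      ext i
      simp only [mem_filter, mem_range]
      omega
    have hsum : ∑ i : Fin N, (if (i : ℕ) + 1 ≤ n then ((i : ℕ).choose k : ℝ) else 0) =
        (n : ℕ).choose (k + 1) := by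
      rw [Fin.sum_univ_eq_sum_range (fun i => if i + 1 ≤ (n : ℕ) then (i.choose k : ℝ) else 0),
        ← sum_filter, hfilter, ← Nat.cast_sum, sum_range_choose_eq_choose_succ]
    simp only [oneDirectSum_zero_succ, oneDirectSum_succ_succ, mul_zero, zero_add, lowerOnes,
      leadingSubmatrix, pascalMatrix, submatrix_apply, of_apply, Fin.le_def, Fin.val_succ, ite_mul,
      one_mul, zero_mul, hsum]

theorem leadingSubmatrix_pascalMatrix_isTotallyPositive (N : ℕ) :
    (leadingSubmatrix pascalMatrix N).IsTotallyPositive := by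
  induction N with
  | zero => exact isTotallyPositive_of_isEmpty _
  | succ N ih =>
    rw [leadingSubmatrix_pascalMatrix_succ]
    exact isTotallyPositive_mul lowerOnes_isTotallyPositive (oneDirectSum_isTotallyPositive ih)

theorem treeNumber_eq_zero_of_lt {n k : ℕ} (h : n < k) : treeNumber n k = 0 := by
  simp [treeNumber, Nat.choose_eq_zero_of_lt h]

theorem forestNumber_succ_succ (n k : ℕ) :
    forestNumber (n + 1) (k + 1) = n.choose k * (n + 1) ^ (n - k) := by
  rcases lt_or_ge n k with h | h
  · simp [forestNumber, Nat.choose_eq_zero_of_lt h]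
  · simp [forestNumber, h]

theorem forestNumber_add_treeNumber (n k : ℕ) :
    forestNumber n k + (k + 1) * treeNumber n (k + 1) = treeNumber n k := by
  obtain _ | n := n
  · cases k <;> simp [forestNumber, treeNumber]
  obtain _ | k := k
  · simp [forestNumber, treeNumber, pow_succ, mul_comm]
  rw [forestNumber_succ_succ]
  rcases lt_or_ge k n with h | h
  · have absorption : (n + 1) * n.choose (k + 1) = (n + 1).choose (k + 1 + 1) * (k + 1 + 1) :=
      Nat.add_one_mul_choose_eq n (k + 1)
    have exponent : n - k = n - (k + 1) + 1 := by omega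
    rw [treeNumber, treeNumber, Nat.add_sub_add_right, Nat.add_sub_add_right, exponent,
      Nat.choose_succ_succ n k]
    calc n.choose k * (n + 1) ^ (n - (k + 1) + 1) +
          (k + 1 + 1) * ((n + 1).choose (k + 1 + 1) * (n + 1) ^ (n - (k + 1)))
        = (n.choose k * (n + 1) + (n + 1).choose (k + 1 + 1) * (k + 1 + 1)) *
            (n + 1) ^ (n - (k + 1)) := by ring
      _ = (n.choose k + n.choose (k + 1)) * (n + 1) ^ (n - (k + 1) + 1) := by
          rw [← absorption]
          ring
  · rw [treeNumber_eq_zero_of_lt (by omega), treeNumber, Nat.add_sub_add_right,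
      Nat.choose_succ_succ, Nat.choose_eq_zero_of_lt (Nat.lt_succ_of_le h)]
    simp

theorem factorial_mul_treeNumber {n k N : ℕ} (hn : n < N) (hk : k ≤ N) :
    k.factorial * treeNumber n k = ∑ i ∈ Ico k N, i.factorial * forestNumber n i := by
  have telescope : k.factorial * treeNumber n k =
      ∑ i ∈ Ico k N, i.factorial * forestNumber n i + N.factorial * treeNumber n N := by
    clear hn
    induction N, hk using Nat.le_induction with
    | base => simp
    | succ N hkN ih =>
      rw [ih, sum_Ico_succ_top hkN, ← forestNumber_add_treeNumber n N, Nat.factorial_succ]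
      ring
  rw [telescope, treeNumber_eq_zero_of_lt hn, mul_zero, add_zero]

/-- The lower-triangular `N × N` matrix with entries `n! / k!` for `k ≤ n`. -/
noncomputable def factorialRatio (N : ℕ) : Matrix (Fin N) (Fin N) ℝ :=
  of fun n k => ((n : ℕ).factorial : ℝ) * (((k : ℕ).factorial : ℝ)⁻¹ * lowerOnes (Fin N) n k)

theorem factorialRatio_isTotallyPositive (N : ℕ) : (factorialRatio N).IsTotallyPositive :=
  isTotallyPositive_scale lowerOnes_isTotallyPositive (fun _ => by positivity)
    fun _ => by positivity

theorem leadingSubmatrix_treesMatrix (N : ℕ) :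
    leadingSubmatrix treesMatrix N = leadingSubmatrix forestsMatrix N * factorialRatio N := by
  ext n k
  have hfilter : {i ∈ range N | (k : ℕ) ≤ i} = Ico (k : ℕ) N := by
    ext i
    simp only [mem_filter, mem_range, mem_Ico, and_comm]
  have htree : ((k : ℕ).factorial : ℝ) * treeNumber n k =
      ∑ i : Fin N, if k ≤ i then ((i : ℕ).factorial : ℝ) * forestNumber n i else 0 := by
    simp only [Fin.le_def]
    rw [Fin.sum_univ_eq_sum_range
      (fun i => if (k : ℕ) ≤ i then (i.factorial : ℝ) * forestNumber n i else 0),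
      ← sum_filter, hfilter]
    exact_mod_cast factorial_mul_treeNumber n.isLt k.isLt.le
  have hk : ((k : ℕ).factorial : ℝ) ≠ 0 := by positivity
  apply mul_left_cancel₀ hk
  simp only [leadingSubmatrix, treesMatrix, submatrix_apply, of_apply, htree, mul_apply, mul_sum]
  refine sum_congr rfl fun i _ => ?_
  simp only [forestsMatrix, factorialRatio, lowerOnes, of_apply]
  split_ifs
  · field_simp
  · simp

theorem sum_choose_mul_pow_mul_choose {R : Type*} [CommSemiring R] (x : R) (n k : ℕ) :
    ∑ i ∈ range (n + 1), (n.choose i * x ^ (n - i)) * i.choose k =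
      n.choose k * (x + 1) ^ (n - k) := by
  rcases lt_or_ge n k with h | h
  · rw [Nat.choose_eq_zero_of_lt h, Nat.cast_zero, zero_mul]
    refine sum_eq_zero fun i hi => ?_
    rw [Nat.choose_eq_zero_of_lt ((mem_range_succ_iff.1 hi).trans_lt h), Nat.cast_zero, mul_zero]
  obtain ⟨d, rfl⟩ := Nat.exists_eq_add_of_le h
  have head_eq_zero : ∑ i ∈ range k,
      ((k + d).choose i * x ^ (k + d - i)) * (i.choose k : R) = 0 :=
    sum_eq_zero fun i hi => by simp [Nat.choose_eq_zero_of_lt (mem_range.1 hi)]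
  rw [add_assoc, sum_range_add, head_eq_zero, zero_add, Nat.add_sub_cancel_left, add_comm x,
    add_pow, mul_sum]
  refine sum_congr rfl fun j _ => ?_
  have trinomial : ((k + d).choose (k + j) : R) * (k + j).choose k =
      (k + d).choose k * d.choose j := by
    have hnat := Nat.choose_mul (n := k + d) (Nat.le_add_right k j)
    simp only [Nat.add_sub_cancel_left] at hnat
    exact_mod_cast congrArg (Nat.cast (R := R)) hnat
  rw [Nat.add_sub_add_left, mul_right_comm, trinomial, one_pow]
  ring

theorem sum_treeNumber_mul_choose {n N : ℕ} (hn : n < N) (k : ℕ) :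
    ∑ i ∈ range N, treeNumber n i * i.choose k = forestNumber (n + 1) (k + 1) := by
  have tail_eq_zero : ∀ i ≥ n + 1, treeNumber n i * i.choose k = 0 := fun i hi => by
    rw [treeNumber_eq_zero_of_lt hi, zero_mul]
  rw [eventually_constant_sum tail_eq_zero hn, forestNumber_succ_succ]
  exact sum_choose_mul_pow_mul_choose n n k

theorem leadingSubmatrix_forestsMatrix_succ (N : ℕ) :
    leadingSubmatrix forestsMatrix (N + 1) =
      oneDirectSum (leadingSubmatrix treesMatrix N * leadingSubmatrix pascalMatrix N) := by
  ext n k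
  cases n using Fin.cases with
  | zero => cases k using Fin.cases <;> simp [leadingSubmatrix, forestsMatrix, forestNumber]
  | succ n =>
    cases k using Fin.cases with
    | zero => simp [leadingSubmatrix, forestsMatrix, forestNumber]
    | succ k =>
      have hsum := Fin.sum_univ_eq_sum_range (fun i => (treeNumber n i * i.choose k : ℝ)) N
      simp only [oneDirectSum_succ_succ, mul_apply, leadingSubmatrix, forestsMatrix, treesMatrix,
        pascalMatrix, submatrix_apply, of_apply, Fin.val_succ, hsum]
      exact_mod_cast (sum_treeNumber_mul_choose n.isLt k).symm

theorem leadingSubmatrix_treesMatrix_isTotallyPositive {N : ℕ}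
    (h : (leadingSubmatrix forestsMatrix N).IsTotallyPositive) :
    (leadingSubmatrix treesMatrix N).IsTotallyPositive := by
  rw [leadingSubmatrix_treesMatrix]
  exact isTotallyPositive_mul h (factorialRatio_isTotallyPositive N)

theorem leadingSubmatrix_forestsMatrix_isTotallyPositive (N : ℕ) :
    (leadingSubmatrix forestsMatrix N).IsTotallyPositive := by
  induction N with
  | zero => exact isTotallyPositive_of_isEmpty _
  | succ N ih =>
    rw [leadingSubmatrix_forestsMatrix_succ]
    exact oneDirectSum_isTotallyPositive <| isTotallyPositive_mul
      (leadingSubmatrix_treesMatrix_isTotallyPositive ih)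
      (leadingSubmatrix_pascalMatrix_isTotallyPositive N)

theorem theorem1p1 :
    forestsMatrix.IsTotallyPositive ∧ treesMatrix.IsTotallyPositive := by
  have forests := leadingSubmatrix_forestsMatrix_isTotallyPositive
  exact ⟨isTotallyPositive_of_leadingSubmatrix forests, isTotallyPositive_of_leadingSubmatrix
    fun N => leadingSubmatrix_treesMatrix_isTotallyPositive (forests N)⟩
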